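/- Let $\mathcal{O}$ be a residually finite Dedekind domain, i.e. a Dedekind domain such that $\mathcal{O}/\mathfrak{a}$ is finite for every nonzero ideal $\mathfrak{a}$, and write $N(\mathfrak{a}) = |\mathcal{O}/\mathfrak{a}|$. Let $\ell \ge 0$ and let $\mathcal{A} \subseteq \mathcal{O}^{\ell}$ be a finite set of column vectors. For a nonzero ideal $\mathfrak{a}$ put $$\chi_{\mathcal{A}}^{\mathrm{quasi}}(\mathfrak{a}) = |M(\mathcal{A}(\mathcal{O}/\mathfrak{a}))|, \qquad M(\mathcal{A}(\mathcal{O}/\mathfrak{a})) = (\mathcal{O}/\mathfrak{a})^{\ell} \setminus \bigcup_{c \in \mathcal{A}} \{ [x] : xc \equiv 0 \ (\mathrm{mod}\ \mathfrak{a}) \}.$$ For $J \subseteq \mathcal{A}$ let $\phi_J : \mathcal{O}^{\ell} \to \mathcal{O}^{J}$, $x \mapsto (xc)_{c \in J}$, and let $r(J)$ be the rank of $\operatorname{im} \phi_J$ (so $r(\varnothing) = 0$). (1) For every $J \subseteq \mathcal{A}$ there are nonzero ideals $\mathfrak{d}_{J,1} \mid \mathfrak{d}_{J,2} \mid \dots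 \mid \mathfrak{d}_{J,r(J)}$ with $$\operatorname{tors}(\operatorname{coker} \phi_J) \simeq \bigoplus_{i=1}^{r(J)} \mathcal{O}/\mathfrak{d}_{J,i}.$$ For any such ideals put $m(J,\mathfrak{a}) = \prod_{i=1}^{r(J)} N(\mathfrak{a} + \mathfrak{d}_{J,i})$ (so $m(\varnothing, \mathfrak{a}) = 1$), let $$\rho_{\mathcal{A}} = \operatorname{lcm}\{ \mathfrak{d}_{J,r(J)} : \varnothing \ne J \subseteq \mathcal{A} \}$$ be the LCM-period, where $\mathfrak{d}_{J,r(J)}$ is read as $\mathcal{O}$ if $r(J) = 0$, and for an ideal $\kappa$ let $$f_{\mathcal{A}}^{\kappa}(t) = \sum_{J \subseteq \mathcal{A}} (-1)^{|J|}\, m(J,\kappa)\, t^{\ell - r(J)} \in \mathbb{Z}[t].$$ Then the following hold. (2) $\chi_{\mathcal{A}}^{\mathrm{quasi}}$ is a quasi-polynomial on the set of nonzero ideals of $\mathcal{O}$ with period $\rho_{\mathcal{A}}$ and with $f_{\mathcal{A}}^{\kappa}$ as $\kappa$-constituent for each $\kappa \mid \rho_{\mathcal{A}}$. That is, $\rho_{\mathcal{A}}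 \neq 0$, and $\chi_{\mathcal{A}}^{\mathrm{quasi}}(\mathfrak{a}) = f_{\mathcal{A}}^{\kappa}(N(\mathfrak{a}))$ for all ideals $\kappa \mid \rho_{\mathcal{A}}$ and all nonzero ideals $\mathfrak{a}$ with $\mathfrak{a} + \rho_{\mathcal{A}} = \kappa$. (3) If $0 \notin \mathcal{A}$, then this quasi-polynomial is monic of degree $\ell$, i.e. $f_{\mathcal{A}}^{\kappa}$ is monic of degree $\ell$ for every $\kappa \mid \rho_{\mathcal{A}}$. (4) For all $J \subseteq \mathcal{A}$ and all nonzero ideals $\mathfrak{a}$, with $T = \operatorname{tors}(\operatorname{coker} \phi_J)$, one has $m(J,\mathfrak{a}) = |T/\mathfrak{a}T|$. -/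

import Mathlib

open Polynomial

namespace DedekindArrangement

noncomputable section

variable {O : Type*} [CommRing O] {l : ℕ}

/-- The absolute norm `N(𝔞)`: the cardinality of the residue ring `O ⧸ 𝔞`. -/
def idealNorm (a : Ideal O) : ℕ := Nat.card (O ⧸ a)

/-- The hyperplane `{[x] ∈ (O/𝔞)^l | x c ≡ 0 mod 𝔞}` of the `𝔞`-reduced arrangement. -/
def hyperplane (c : Fin l → O) (a : Ideal O) : Set (Fin l → O ⧸ a) :=
  {x | ∑ i, x i * Ideal.Quotient.mk a (c i) = 0}

/-- The complement `M(𝒜(O/𝔞)) = (O/𝔞)^l ∖ ⋃_{c ∈ 𝒜} H_{c,𝔞}`. -/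
def complement (A : Finset (Fin l → O)) (a : Ideal O) : Set (Fin l → O ⧸ a) :=
  Set.univ \ ⋃ c ∈ A, hyperplane c a

/-- The counting function `𝔞 ↦ |M(𝒜(O/𝔞))|`; only its values at nonzero ideals matter. -/
def charQuasi (A : Finset (Fin l → O)) (a : Ideal O) : ℤ := (complement A a).ncard

/-- `φ` is a quasi-polynomial on the set of nonzero ideals with period `ρ` and with `f κ` as
`κ`-constituent for every divisor `κ` of `ρ`. -/
structure IsQuasiPolynomial (φ : Ideal O → ℤ) (ρ : Ideal O) (f : Ideal O → ℤ[X]) : Prop where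
  period_ne_bot : ρ ≠ ⊥
  eval_eq : ∀ κ : Ideal O, κ ∣ ρ → ∀ a : Ideal O, a ≠ ⊥ → a + ρ = κ →
    φ a = (f κ).eval (idealNorm a : ℤ)

/-- The matrix `C_J` whose columns are the elements of `J`. -/
def colMatrix (J : Finset (Fin l → O)) : Matrix (Fin l) J O :=
  Matrix.of fun i c => c.1 i

/-- The homomorphism `φ_J : O^l → O^J`, `x ↦ x C_J`. -/
def phi (J : Finset (Fin l → O)) : (Fin l → O) →ₗ[O] (J → O) :=
  (colMatrix J).vecMulLinear

/-- `r(J)`, the rank of the image of `φ_J`; one has `r(∅) = 0`. -/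
def rk (J : Finset (Fin l → O)) : ℕ := Module.finrank O (LinearMap.range (phi J))

/-- The cokernel of `φ_J`. -/
abbrev Coker (J : Finset (Fin l → O)) : Type _ := (J → O) ⧸ LinearMap.range (phi J)

/-- The torsion submodule of the cokernel of `φ_J`. -/
abbrev TorsCoker (J : Finset (Fin l → O)) : Type _ := Submodule.torsion O (Coker J)

/-- `d 0, …, d (r(J) - 1)` are the invariant ideals `𝔡_{J,1} ∣ ⋯ ∣ 𝔡_{J,r(J)}` of the cokernel
of `φ_J`: nonzero ideals, each dividing the next, with
`tors (coker φ_J) ≃ O/𝔡_{J,1} ⊕ ⋯ ⊕ O/𝔡_{J,r(J)}`. -/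
structure IsInvariantIdeals (J : Finset (Fin l → O)) (d : Fin (rk J) → Ideal O) : Prop where
  ne_bot : ∀ i, d i ≠ ⊥
  dvd : ∀ i j, i ≤ j → d i ∣ d j
  iso : Nonempty (TorsCoker J ≃ₗ[O] ((i : Fin (rk J)) → O ⧸ d i))

/-- The last invariant ideal `𝔡_{J,r(J)}`, and the unit ideal if `r(J) = 0`. -/
def lastIdeal (J : Finset (Fin l → O)) (d : Fin (rk J) → Ideal O) : Ideal O :=
  if h : 0 < rk J then d ⟨rk J - 1, Nat.sub_lt h Nat.one_pos⟩ else ⊤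

/-- The LCM-period: the least common multiple (i.e. the intersection) of the ideals
`𝔡_{J,r(J)}` over the nonempty subsets `J` of `𝒜`. -/
def lcmPeriod (A : Finset (Fin l → O))
    (d : (J : Finset (Fin l → O)) → Fin (rk J) → Ideal O) : Ideal O :=
  (A.powerset.filter fun J => J.Nonempty).inf fun J => lastIdeal J (d J)

/-- `m(J,𝔞) = ∏_i N(𝔞 + 𝔡_{J,i})`; for `J = ∅` this is the empty product `1`. -/
def mult (J : Finset (Fin l → O)) (d : Fin (rk J) → Ideal O) (a : Ideal O) : ℕ :=
  ∏ i, idealNorm (a + d i)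

/-- The polynomial `∑_{J ⊆ 𝒜} (-1)^{|J|} m(J,κ) t^{l - r(J)}`. -/
def constituent (A : Finset (Fin l → O))
    (d : (J : Finset (Fin l → O)) → Fin (rk J) → Ideal O) (κ : Ideal O) : ℤ[X] :=
  ∑ J ∈ A.powerset, C ((-1 : ℤ) ^ J.card * (mult J (d J) κ : ℤ)) * X ^ (l - rk J)

end

end DedekindArrangement

/-! Inclusion–exclusion (`charQuasi_eq_sum`) reduces the count to the sizes of the sets `flat J a`,
each the kernel of `φ_J ⊗ O/𝔞`. Right exactness of the tensor product compares it with `(O/𝔞) ⊗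
coker φ_J` (`card_flat_mul`). The cokernel splits as its torsion `T` plus a projective module of
rank `|J| - r(J)`, so `flat J a` has `|T/𝔞T| N(𝔞)^(l - r(J))` elements (`card_flat`). The
decomposition of `T` turns `|T/𝔞T|` into `m(J,𝔞)`, which depends only on `𝔞 + ρ` because `ρ ⊆
𝔡_{J,i}`.

For the invariant ideals, `T` is a quotient of a submodule of `O^J` of rank `r(J)`. Localizing at
the regular elements that are units modulo `ann T` leaves `T` unchanged and makes the ring
principal, so Smith normal form applies (`exists_linearEquiv_pi_quotient_of_surjective`). Sorting
the exponents prime by prime then gives a divisibility chain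
(`exists_chain_linearEquiv_pi_quotient`). -/

namespace DedekindArrangement

open TensorProduct

/-! ### Semilocalization of a Dedekind domain at a nonzero ideal -/

section Localization

variable {O : Type*} [CommRing O]

/-- The elements of `O` that are regular and become units modulo `I`. -/
def unitsMod (I : Ideal O) : Submonoid O :=
  nonZeroDivisors O ⊓ (IsUnit.submonoid (O ⧸ I)).comap (Ideal.Quotient.mk I)

theorem unitsMod_le_nonZeroDivisors (I : Ideal O) : unitsMod I ≤ nonZeroDivisors O :=
  inf_le_left

theorem isUnit_mk_of_mem_unitsMod {I : Ideal O} {s : O} (hs : s ∈ unitsMod I) :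
    IsUnit (Ideal.Quotient.mk I s) :=
  hs.2

theorem exists_mul_sub_one_mem_of_mem_unitsMod {I : Ideal O} {s : O} (hs : s ∈ unitsMod I) :
    ∃ t, s * t - 1 ∈ I := by
  obtain ⟨t, ht⟩ := isUnit_iff_exists_inv.mp (isUnit_mk_of_mem_unitsMod hs)
  obtain ⟨t, rfl⟩ := Ideal.Quotient.mk_surjective t
  exact ⟨t, by rw [← Ideal.Quotient.eq, map_mul, ht, map_one]⟩

instance isDomain_localization_unitsMod [IsDomain O] (I : Ideal O) :
    IsDomain (Localization (unitsMod I)) :=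
  IsLocalization.isDomain_of_le_nonZeroDivisors _ (unitsMod_le_nonZeroDivisors I)

instance faithfulSMul_localization_unitsMod [IsDomain O] (I : Ideal O) :
    FaithfulSMul O (Localization (unitsMod I)) :=
  (faithfulSMul_iff_algebraMap_injective _ _).mpr
    (IsLocalization.injective _ (unitsMod_le_nonZeroDivisors I))

instance isDedekindDomain_localization_unitsMod [IsDedekindDomain O] (I : Ideal O) :
    IsDedekindDomain (Localization (unitsMod I)) :=
  IsLocalization.isDedekindDomain O (unitsMod_le_nonZeroDivisors I) _

/-- If `I` is not inside the maximal ideal `p`, then `p + I = O`, and `p` contains an element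
congruent to `1` modulo `I`. -/
theorem le_of_disjoint_unitsMod [IsDedekindDomain O] {I p : Ideal O} [p.IsPrime] (hp : p ≠ ⊥)
    (h : Disjoint (unitsMod I : Set O) p) : I ≤ p := by
  have hmax : p.IsMaximal := Ring.DimensionLEOne.maximalOfPrime hp inferInstance
  by_contra hI
  have hsup : p ⊔ I = ⊤ := hmax.1.2 _ (lt_of_le_of_ne le_sup_left fun e => hI (e ▸ le_sup_right))
  obtain ⟨x, hx, y, hy, hxy⟩ := Submodule.mem_sup.mp ((Ideal.eq_top_iff_one _).mp hsup)
  have key : ∀ z ∈ p, z ≠ 0 → IsUnit (Ideal.Quotient.mk I z) → False := fun z hz hz0 hu =>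
    Set.disjoint_left.mp h
      (Submonoid.mem_inf.mpr ⟨mem_nonZeroDivisors_of_ne_zero hz0, hu⟩ : z ∈ unitsMod I) hz
  have hx1 : Ideal.Quotient.mk I x = 1 := by
    rw [← map_one (Ideal.Quotient.mk I), Ideal.Quotient.eq, ← hxy]
    simpa using hy
  -- `x = 0` forces `I = O`; then any nonzero element of `p` serves instead, regularity being the
  -- only condition left.
  by_cases hx0 : x = 0
  · obtain ⟨z, hz, hz0⟩ := Submodule.exists_mem_ne_zero_of_ne_bot hp
    have : Subsingleton (O ⧸ I) := by
      rw [hx0, map_zero] at hx1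
      exact subsingleton_of_zero_eq_one hx1
    exact key z hz hz0 (isUnit_of_subsingleton _)
  · exact key x hx hx0 (hx1 ▸ isUnit_one)

theorem finite_setOf_ideal_le [IsDedekindDomain O] {I : Ideal O} (hI : I ≠ ⊥) :
    {J : Ideal O | I ≤ J}.Finite := by
  let := UniqueFactorizationMonoid.fintypeSubtypeDvd I hI
  have : Finite {J : Ideal O // J ∣ I} := inferInstance
  exact Set.Finite.subset (s := {J : Ideal O | J ∣ I}) this fun J hJ => Ideal.dvd_iff_le.mpr hJ

/-- Primes of the localization contract injectively to `⊥` or to one of the finitely many ideals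
containing `I`, and a Dedekind domain with finitely many primes is principal. -/
theorem isPrincipalIdealRing_localization_unitsMod [IsDedekindDomain O] {I : Ideal O}
    (hI : I ≠ ⊥) : IsPrincipalIdealRing (Localization (unitsMod I)) := by
  refine IsPrincipalIdealRing.of_finite_primes ?_
  refine Set.Finite.of_finite_image
    (f := fun J : Ideal (Localization (unitsMod I)) => J.under O) ?_ ?_
  · refine ((finite_setOf_ideal_le hI).union (Set.finite_singleton ⊥)).subset ?_
    rintro _ ⟨P, hP, rfl⟩
    obtain ⟨h1, h2⟩ := (IsLocalization.isPrime_iff_isPrime_disjoint (unitsMod I) _ P).mp hP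
    by_cases hb : P.under O = ⊥
    · exact Or.inr hb
    · exact Or.inl (le_of_disjoint_unitsMod hb h2)
  · intro P _ Q _ h
    rw [← IsLocalization.map_under (unitsMod I) _ P, ← IsLocalization.map_under (unitsMod I) _ Q]
    exact congrArg _ h

theorem finrank_localization_unitsMod_tensor [IsDomain O] (I : Ideal O) (M : Type*)
    [AddCommGroup M] [Module O M] :
    Module.finrank (Localization (unitsMod I)) (Localization (unitsMod I) ⊗[O] M) =
      Module.finrank O M :=
  (TensorProduct.isBaseChange O M (Localization (unitsMod I))).finrank_eq

/-- An inverse of `s` modulo `I` inverts the action of `s` on a module killed by `I`, so localizing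
changes nothing. -/
theorem bijective_mk_one_of_isTorsionBySet {I : Ideal O} {T : Type*} [AddCommGroup T]
    [Module O T] (hT : Module.IsTorsionBySet O T I) :
    Function.Bijective (TensorProduct.mk O (Localization (unitsMod I)) T 1) := by
  have hinv : ∀ s ∈ unitsMod I, ∃ t, ∀ x : T, (s * t) • x = x := fun s hs => by
    obtain ⟨t, ht⟩ := exists_mul_sub_one_mem_of_mem_unitsMod hs
    refine ⟨t, fun x => ?_⟩
    have := @hT x ⟨_, ht⟩
    simpa [sub_smul, sub_eq_zero] using this
  constructor
  · intro x y h
    obtain ⟨⟨s, hs⟩, hc⟩ := IsLocalizedModule.exists_of_eq (S := unitsMod I) h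
    obtain ⟨t, ht⟩ := hinv s hs
    have hc' : s • x = s • y := hc
    rw [← ht x, ← ht y, mul_comm, mul_smul, mul_smul, hc']
  · intro y
    obtain ⟨⟨x, ⟨s, hs⟩⟩, hc⟩ := IsLocalizedModule.surj (unitsMod I)
      (TensorProduct.mk O (Localization (unitsMod I)) T 1) y
    obtain ⟨t, ht⟩ := hinv s hs
    refine ⟨t • x, ?_⟩
    have hc' : s • y = TensorProduct.mk O (Localization (unitsMod I)) T 1 x := hc
    have hx : x = (s * t) • x := (ht x).symm
    have : s • TensorProduct.mk O (Localization (unitsMod I)) T 1 (t • x) = s • y := by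
      rw [hc', ← map_smul, ← mul_smul, ht]
    have hu := IsLocalizedModule.map_units (S := unitsMod I)
      (TensorProduct.mk O (Localization (unitsMod I)) T 1) ⟨s, hs⟩
    exact ((Module.End.isUnit_iff _).mp hu).1 this

end Localization

/-! ### Torsion modules as sums of cyclic modules -/

section Structure

variable {O : Type*} [CommRing O] [IsDedekindDomain O]

/-- A torsion quotient of a torsion-free module of rank `n` is a direct sum of `n` cyclic
modules with nonzero annihilators. -/
theorem exists_linearEquiv_pi_quotient_of_surjective {P T : Type*} [AddCommGroup P] [Module O P]
    [Module.Finite O P] [Module.IsTorsionFree O P] [AddCommGroup T] [Module O T]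
    (hT : Module.IsTorsion O T) (f : P →ₗ[O] T) (hf : Function.Surjective f) {n : ℕ}
    (hn : Module.finrank O P = n) :
    ∃ b : Fin n → Ideal O, (∀ i, b i ≠ ⊥) ∧ Nonempty (T ≃ₗ[O] ((i : Fin n) → O ⧸ b i)) := by
  have hfin : Module.Finite O T := .of_surjective f hf
  obtain ⟨s, hs, hs0⟩ := Submodule.annihilator_top_inter_nonZeroDivisors hT
  set I : Ideal O := (⊤ : Submodule O T).annihilator
  have hI : I ≠ ⊥ := fun h => nonZeroDivisors.ne_zero hs0 (by simpa [h] using hs)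
  have hTI : Module.IsTorsionBySet O T I := fun x a =>
    Submodule.mem_annihilator.mp a.2 x trivial
  have := isPrincipalIdealRing_localization_unitsMod hI
  let R := Localization (unitsMod I)
  have hflat : Module.Flat R (R ⊗[O] P) := inferInstance
  have htf : Module.IsTorsionFree R (R ⊗[O] P) := inferInstance
  have hfree : Module.Free R (R ⊗[O] P) := inferInstance
  have hn' : Module.finrank R (R ⊗[O] P) = n :=
    (finrank_localization_unitsMod_tensor I P).trans hn
  let g : R ⊗[O] P →ₗ[R] R ⊗[O] T := f.baseChange R
  have hg : Function.Surjective g := LinearMap.lTensor_surjective R hf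
  have hT0 : Module.finrank R (R ⊗[O] T) = 0 :=
    (finrank_localization_unitsMod_tensor I T).trans (Module.finrank_eq_zero_iff_isTorsion.mpr hT)
  -- Full rank of the kernel is what yields exactly `n` nonzero Smith coefficients.
  have hker : Module.finrank R (LinearMap.ker g) = Module.finrank R (R ⊗[O] P) := by
    have h := Submodule.finrank_quotient_add_finrank (LinearMap.ker g)
    rwa [(g.quotKerEquivOfSurjective hg).finrank_eq, hT0, zero_add] at h
  let b := Module.finBasisOfFinrankEq R (R ⊗[O] P) hn'
  let a := Submodule.smithNormalFormCoeffs b hker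
  let e1 : (R ⊗[O] T) ≃ₗ[R] ((i : Fin n) → R ⧸ Ideal.span {a i}) :=
    (g.quotKerEquivOfSurjective hg).symm.trans ((LinearMap.ker g).quotientEquivPiSpan b hker)
  let e2 : T ≃ₗ[O] (R ⊗[O] T) := LinearEquiv.ofBijective _ (bijective_mk_one_of_isTorsionBySet hTI)
  let e3 : T ≃ₗ[O] ((i : Fin n) → R ⧸ Ideal.span {a i}) := e2.trans (e1.restrictScalars O)
  have hkill : ∀ i, Module.IsTorsionBySet O (R ⧸ Ideal.span {a i}) I := fun i x c => by
    have h := @hTI (e3.symm (Pi.single i x)) c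
    rw [← map_smul] at h
    have h' := (LinearEquiv.map_eq_zero_iff _).mp h
    have := congrFun h' i
    simpa using this
  -- Each summand over `R` is cyclic over `O`: it is killed by `I`, so denominators can be inverted
  -- modulo `I`.
  let q : (i : Fin n) → O →ₗ[O] R ⧸ Ideal.span {a i} := fun i =>
    ((Ideal.span {a i}).mkQ.restrictScalars O).comp (Algebra.linearMap O R)
  have hq : ∀ i, Function.Surjective (q i) := fun i y => by
    obtain ⟨y, rfl⟩ := Submodule.mkQ_surjective _ y
    obtain ⟨⟨x, ⟨s, hs⟩⟩, hc⟩ := IsLocalization.surj (unitsMod I) y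
    obtain ⟨t, ht⟩ := exists_mul_sub_one_mem_of_mem_unitsMod hs
    refine ⟨t * x, ?_⟩
    have h := @hkill i ((Ideal.span {a i}).mkQ y) ⟨_, ht⟩
    have h2 : (s * t) • (Ideal.span {a i}).mkQ y = (Ideal.span {a i}).mkQ y := by
      simpa [sub_smul, sub_eq_zero] using h
    rw [← h2]
    have hc' : y * algebraMap O R s = algebraMap O R x := hc
    change (Ideal.span {a i}).mkQ (algebraMap O R (t * x)) = _
    rw [map_mul, ← hc', ← LinearMap.map_smul_of_tower, Algebra.smul_def,
      map_mul (algebraMap O R) s t]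
    congr 1
    ring
  refine ⟨fun i => LinearMap.ker (q i), fun i hbot => hI (le_bot_iff.mp ?_),
    ⟨e3.trans (LinearEquiv.piCongrRight fun i => ((q i).quotKerEquivOfSurjective (hq i)).symm)⟩⟩
  rw [← hbot]
  intro c hc
  rw [LinearMap.mem_ker, ← mul_one c, ← smul_eq_mul, map_smul]
  exact @hkill i _ ⟨c, hc⟩

/-- The Chinese remainder theorem for a product of powers of distinct primes, as an isomorphism
of modules. -/
noncomputable def quotientProdPowLinearEquiv {ι : Type*} [Fintype ι] (p : ι → Ideal O)
    (e : ι → ℕ) (prime : ∀ i, Prime (p i)) (hp : Function.Injective p) :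
    (O ⧸ ∏ i, p i ^ e i) ≃ₗ[O] ((i : ι) → O ⧸ p i ^ e i) :=
  { (IsDedekindDomain.quotientEquivPiOfProdEq _ p e prime (fun _ _ h => hp.ne h) rfl).toAddEquiv
      with
    map_smul' := fun r x => by
      obtain ⟨x, rfl⟩ := Ideal.Quotient.mk_surjective x
      rfl }

open UniqueFactorizationMonoid in
theorem exists_finset_prod_pow {ι : Type*} [Finite ι] (a : ι → Ideal O) (ha : ∀ i, a i ≠ ⊥) :
    ∃ (s : Finset (Ideal O)) (e : s → ι → ℕ), (∀ p : s, Prime (p : Ideal O)) ∧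
      ∀ i, a i = ∏ p : s, (p : Ideal O) ^ e p i := by
  classical
  have := Fintype.ofFinite ι
  refine ⟨Finset.univ.biUnion fun i => (normalizedFactors (a i)).toFinset,
    fun p i => (normalizedFactors (a i)).count (p : Ideal O), ?_, fun i => ?_⟩
  · rintro ⟨p, hp⟩
    obtain ⟨i, -, hi⟩ := Finset.mem_biUnion.mp hp
    exact prime_of_normalized_factor p (Multiset.mem_toFinset.mp hi)
  · rw [Finset.prod_coe_sort (Finset.univ.biUnion fun i => (normalizedFactors (a i)).toFinset)
      (fun p => p ^ (normalizedFactors (a i)).count p)]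
    conv_lhs => rw [← Ideal.prod_normalizedFactors_eq_self (ha i)]
    exact Finset.prod_multiset_count_of_subset _ _
      (Finset.subset_biUnion_of_mem (fun i => (normalizedFactors (a i)).toFinset)
        (Finset.mem_univ i))

/-- A finite direct sum of cyclic torsion modules can be rearranged so that the annihilators
form a divisibility chain. -/
theorem exists_chain_linearEquiv_pi_quotient {n : ℕ} (a : Fin n → Ideal O)
    (ha : ∀ i, a i ≠ ⊥) :
    ∃ d : Fin n → Ideal O, (∀ i, d i ≠ ⊥) ∧ (∀ i j, i ≤ j → d i ∣ d j) ∧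
      Nonempty (((i : Fin n) → O ⧸ a i) ≃ₗ[O] ((i : Fin n) → O ⧸ d i)) := by
  obtain ⟨s, e, hs, hae⟩ := exists_finset_prod_pow a ha
  obtain rfl : a = fun i => ∏ p : s, (p : Ideal O) ^ e p i := funext hae
  -- Each prime gets its own permutation, which is harmless since the primary parts are independent.
  let σ : s → Equiv.Perm (Fin n) := fun p => Tuple.sort (e p)
  refine ⟨fun i => ∏ p : s, (p : Ideal O) ^ e p (σ p i), fun i => ?_, fun i j hij => ?_, ⟨?_⟩⟩
  · exact Finset.prod_ne_zero_iff.mpr fun p _ => pow_ne_zero _ (hs p).ne_zero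
  · exact Finset.prod_dvd_prod_of_dvd _ _ fun p _ =>
      pow_dvd_pow _ (Tuple.monotone_sort (e p) hij)
  · have crt : ∀ f : s → Fin n → ℕ,
        ((i : Fin n) → O ⧸ ∏ p : s, (p : Ideal O) ^ f p i) ≃ₗ[O]
          ((p : s) → (i : Fin n) → O ⧸ (p : Ideal O) ^ f p i) := fun f =>
      (LinearEquiv.piCongrRight fun i => quotientProdPowLinearEquiv (fun p : s => (p : Ideal O))
        (fun p => f p i) hs Subtype.val_injective).trans
      { Equiv.piComm _ with
        map_add' := fun _ _ => rfl
        map_smul' := fun _ _ => rfl }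
    exact ((crt e).trans (LinearEquiv.piCongrRight fun p =>
      (LinearEquiv.piCongrLeft O (fun i => O ⧸ (p : Ideal O) ^ e p i) (σ p)).symm)).trans
      (crt fun p i => e p (σ p i)).symm

end Structure

/-! ### Sizes of finite modules tensored with a residue ring -/

section Counting

variable {O : Type*} [CommRing O] [IsDedekindDomain O]

theorem card_quotient_tensor_of_isTorsionFree {a : Ideal O} (ha : a ≠ ⊥) (F : Type*)
    [AddCommGroup F] [Module O F] [Module.Finite O F] [Module.IsTorsionFree O F] :
    Nat.card ((O ⧸ a) ⊗[O] F) = idealNorm a ^ Module.finrank O F := by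
  have := isPrincipalIdealRing_localization_unitsMod ha
  let R := Localization (unitsMod a)
  -- Since `O ⧸ a` is an algebra over the principal ring `R`, the tensor product can be computed
  -- from the free module `R ⊗ F`.
  let φ : R →+* O ⧸ a := IsLocalization.lift (M := unitsMod a) (g := Ideal.Quotient.mk a)
    fun s => isUnit_mk_of_mem_unitsMod s.2
  let : Algebra R (O ⧸ a) := φ.toAlgebra
  have : IsScalarTower O R (O ⧸ a) := .of_algebraMap_eq fun x =>
    (IsLocalization.lift_eq (M := unitsMod a) _ x).symm
  have hflat : Module.Flat R (R ⊗[O] F) := inferInstance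
  have htf : Module.IsTorsionFree R (R ⊗[O] F) := inferInstance
  have hfree : Module.Free R (R ⊗[O] F) := inferInstance
  let b := Module.finBasisOfFinrankEq R (R ⊗[O] F) (finrank_localization_unitsMod_tensor a F)
  let e : (O ⧸ a) ⊗[O] F ≃ₗ[R] (Fin (Module.finrank O F) → O ⧸ a) :=
    (AlgebraTensorModule.cancelBaseChange O R R (O ⧸ a) F).symm.trans
      ((TensorProduct.congr (.refl R _) b.equivFun).trans
        (TensorProduct.piScalarRight R R (O ⧸ a) (Fin (Module.finrank O F))))
  rw [Nat.card_congr e.toEquiv, Nat.card_pi]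
  simp [idealNorm]

theorem card_quotient_tensor_eq_torsion_mul {a : Ideal O} (ha : a ≠ ⊥) (M : Type*)
    [AddCommGroup M] [Module O M] [Module.Finite O M] :
    Nat.card ((O ⧸ a) ⊗[O] M) =
      Nat.card ((O ⧸ a) ⊗[O] Submodule.torsion O M) * idealNorm a ^ Module.finrank O M := by
  let T := Submodule.torsion O M
  have : Module.Projective O (M ⧸ T) := by
    have : Module.FinitePresentation O (M ⧸ T) := Module.finitePresentation_of_finite O _
    exact Module.Flat.projective_of_finitePresentation
  obtain ⟨l, hl⟩ := Module.projective_lifting_property T.mkQ LinearMap.id T.mkQ_surjective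
  let e := (Function.Exact.splitSurjectiveEquiv (LinearMap.exact_subtype_mkQ T)
    T.injective_subtype ⟨l, hl⟩).1
  have hr : Module.finrank O (M ⧸ T) = Module.finrank O M := by
    have h := Submodule.finrank_quotient_add_finrank T
    rwa [Module.finrank_eq_zero_iff_isTorsion.mpr (Submodule.torsion_isTorsion (M := M)), add_zero] at h
  rw [← hr, ← card_quotient_tensor_of_isTorsionFree ha (M ⧸ T), ← Nat.card_prod]
  exact Nat.card_congr ((TensorProduct.congr (.refl O (O ⧸ a)) e).trans
    (TensorProduct.prodRight O O _ _ _)).toEquiv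

end Counting

/-! ### The multiplicity as the size of the reduced torsion -/

section Multiplicity

variable {O : Type*} [CommRing O]

theorem card_quotient_tensor_quotient (a b : Ideal O) :
    Nat.card ((O ⧸ a) ⊗[O] (O ⧸ b)) = idealNorm (a + b) := by
  have h : (a • ⊤ : Submodule O (O ⧸ b)) = Submodule.map b.mkQ a := by
    have := Submodule.map_smul'' a (⊤ : Submodule O O) b.mkQ
    rw [Submodule.map_top, Submodule.range_mkQ] at this
    rw [← this]
    simp
  rw [Nat.card_congr (TensorProduct.quotTensorEquivQuotSMul (O ⧸ b) a).toEquiv, h,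
    Nat.card_congr (Submodule.quotientQuotientEquivQuotientSup b a).toEquiv, sup_comm]
  rfl

theorem card_quotient_tensor_pi_quotient (a : Ideal O) {n : ℕ} (d : Fin n → Ideal O) :
    Nat.card ((O ⧸ a) ⊗[O] ((i : Fin n) → O ⧸ d i)) = ∏ i, idealNorm (a + d i) := by
  rw [Nat.card_congr (TensorProduct.piRight O O (O ⧸ a) (fun i => O ⧸ d i)).toEquiv, Nat.card_pi]
  exact Finset.prod_congr rfl fun i _ => card_quotient_tensor_quotient a (d i)

variable {l : ℕ}

theorem phi_apply (J : Finset (Fin l → O)) (x : Fin l → O) (c : J) :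
    phi J x c = ∑ i, x i * c.1 i := rfl

theorem card_quotient_tensor_torsCoker {J : Finset (Fin l → O)} {d : Fin (rk J) → Ideal O}
    (hd : IsInvariantIdeals J d) (a : Ideal O) :
    Nat.card ((O ⧸ a) ⊗[O] TorsCoker J) = mult J d a := by
  obtain ⟨e⟩ := hd.iso
  rw [Nat.card_congr (TensorProduct.congr (.refl O (O ⧸ a)) e).toEquiv]
  exact card_quotient_tensor_pi_quotient a d

end Multiplicity

/-! ### Bounds on the rank -/

section Rank

variable {O : Type*} [CommRing O] [IsDomain O] {l : ℕ}

theorem finrank_coker_add_rk (J : Finset (Fin l → O)) :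
    Module.finrank O (Coker J) + rk J = J.card := by
  rw [rk, Submodule.finrank_quotient_add_finrank, Module.finrank_fintype_fun_eq_card,
    Fintype.card_coe]

theorem rk_le (J : Finset (Fin l → O)) : rk J ≤ l := by
  simpa [rk] using LinearMap.finrank_range_le (phi J)

theorem rk_le_card (J : Finset (Fin l → O)) : rk J ≤ J.card := by
  have := finrank_coker_add_rk J
  omega

theorem rk_empty : rk (∅ : Finset (Fin l → O)) = 0 := by
  simpa using rk_le_card (∅ : Finset (Fin l → O))

theorem rk_pos_of_mem {J : Finset (Fin l → O)} {c : Fin l → O} (hc : c ∈ J) (hc0 : c ≠ 0) :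
    0 < rk J := by
  rw [Nat.pos_iff_ne_zero]
  intro h
  have hr : LinearMap.range (phi J) = ⊥ := Submodule.finrank_eq_zero.mp h
  refine hc0 (funext fun i => ?_)
  have := congrFun (LinearMap.congr_fun (LinearMap.range_eq_bot.mp hr) (Pi.single i 1)) ⟨c, hc⟩
  rw [phi_apply] at this
  simpa [Pi.single_apply] using this

end Rank

section LastIdeal

variable {O : Type*} [CommRing O] {l : ℕ}

theorem lastIdeal_le {J : Finset (Fin l → O)} {d : Fin (rk J) → Ideal O}
    (hd : IsInvariantIdeals J d) (i : Fin (rk J)) : lastIdeal J d ≤ d i := by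
  rw [lastIdeal, dif_pos i.pos]
  exact Ideal.le_of_dvd (hd.dvd _ _ (Nat.le_sub_one_of_lt i.2))

end LastIdeal

/-! ### Existence of the invariant ideals -/

section InvariantIdeals

variable {O : Type*} [CommRing O] [IsDedekindDomain O] {l : ℕ}

theorem exists_isInvariantIdeals (J : Finset (Fin l → O)) :
    ∃ d : Fin (rk J) → Ideal O, IsInvariantIdeals J d := by
  let N := LinearMap.range (phi J)
  -- Using the saturation `P` of the image, rather than all of `O^J`, bounds the number of summands
  -- by `r(J)`: `P/N` is torsion.
  let P : Submodule O (J → O) := (Submodule.torsion O (Coker J)).comap N.mkQ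
  let f : P →ₗ[O] TorsCoker J := N.mkQ.restrict fun _ hx => hx
  have hf : Function.Surjective f := fun ⟨y, hy⟩ => by
    obtain ⟨x, rfl⟩ := N.mkQ_surjective y
    exact ⟨⟨x, hy⟩, rfl⟩
  have hT : Module.IsTorsion O (TorsCoker J) := Submodule.torsion_isTorsion
  have hNP : N ≤ P := fun x hx => by
    have : N.mkQ x = 0 := (Submodule.Quotient.mk_eq_zero N).mpr hx
    simp [P, this]
  have hker : LinearMap.ker f = N.comap P.subtype := by
    ext x
    rw [LinearMap.mem_ker, ← Subtype.coe_inj]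
    exact Submodule.Quotient.mk_eq_zero N
  have hP : Module.finrank O P = rk J := by
    rw [← Submodule.finrank_quotient_add_finrank (LinearMap.ker f),
      (f.quotKerEquivOfSurjective hf).finrank_eq, Module.finrank_eq_zero_iff_isTorsion.mpr hT,
      hker, (Submodule.comapSubtypeEquivOfLe hNP).finrank_eq, zero_add]
    rfl
  obtain ⟨b, hb, ⟨e⟩⟩ := exists_linearEquiv_pi_quotient_of_surjective hT f hf hP
  obtain ⟨d, hd, hchain, ⟨e'⟩⟩ := exists_chain_linearEquiv_pi_quotient b hb
  exact ⟨d, hd, hchain, ⟨e.trans e'⟩⟩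

end InvariantIdeals

/-! ### Counting points on intersections of hyperplanes -/

section Counting

variable {O : Type*} [CommRing O] {l : ℕ}

/-- The intersection of the hyperplanes indexed by `J`. -/
def flat (J : Finset (Fin l → O)) (a : Ideal O) : Set (Fin l → O ⧸ a) :=
  ⋂ c ∈ J, hyperplane c a

theorem piScalarRight_lTensor_phi (J : Finset (Fin l → O)) [DecidableEq J] (a : Ideal O)
    (t : (O ⧸ a) ⊗[O] (Fin l → O)) (c : J) :
    TensorProduct.piScalarRight O O (O ⧸ a) J (LinearMap.lTensor (O ⧸ a) (phi J) t) c =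
      ∑ i, TensorProduct.piScalarRight O O (O ⧸ a) (Fin l) t i *
        Ideal.Quotient.mk a (c.1 i) := by
  induction t with
  | zero => simp
  | add x y hx hy =>
    simp only [map_add, Pi.add_apply, hx, hy, add_mul, Finset.sum_add_distrib]
  | tmul y x =>
    obtain ⟨y, rfl⟩ := Ideal.Quotient.mk_surjective y
    simp only [LinearMap.lTensor_tmul, TensorProduct.piScalarRight_apply,
      TensorProduct.piScalarRightHom_tmul, phi_apply, Algebra.smul_def,
      Ideal.Quotient.algebraMap_eq, map_sum, map_mul, Finset.sum_mul]
    exact Finset.sum_congr rfl fun i _ => by ring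

/-- Both sides equal `|ker| · |range| · |coker|` for the reduction of `φ_J` modulo `𝔞`. -/
theorem card_flat_mul (J : Finset (Fin l → O)) (a : Ideal O) :
    Nat.card (flat J a) * idealNorm a ^ J.card =
      Nat.card ((O ⧸ a) ⊗[O] Coker J) * idealNorm a ^ l := by
  classical
  let g := LinearMap.lTensor (O ⧸ a) (phi J)
  let e₁ := TensorProduct.piScalarRight O O (O ⧸ a) (Fin l)
  let e₂ := TensorProduct.piScalarRight O O (O ⧸ a) J
  have hker : Nat.card (LinearMap.ker g) = Nat.card (flat J a) := by
    refine Nat.card_congr (e₁.toEquiv.subtypeEquiv fun t => ?_)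
    rw [LinearMap.mem_ker, ← e₂.map_eq_zero_iff, funext_iff]
    simp only [flat, Set.mem_iInter, hyperplane, Subtype.forall]
    exact forall₂_congr fun c hc => by
      rw [piScalarRight_lTensor_phi J a t ⟨c, hc⟩]
      rfl
  have h₁ : idealNorm a ^ l = Nat.card (LinearMap.ker g) * Nat.card (LinearMap.range g) := by
    rw [← Nat.card_congr g.quotKerEquivRange.toEquiv, ← Submodule.card_eq_card_quotient_mul_card,
      Nat.card_congr e₁.toEquiv, Nat.card_fun]
    simp [idealNorm]
  have h₂ : idealNorm a ^ J.card =
      Nat.card (LinearMap.range g) * Nat.card ((O ⧸ a) ⊗[O] Coker J) := by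
    rw [← Nat.card_congr (lTensor.equiv (O ⧸ a) (LinearMap.exact_map_mkQ_range (phi J))
      (Submodule.mkQ_surjective _)).toEquiv, ← Submodule.card_eq_card_quotient_mul_card,
      Nat.card_congr e₂.toEquiv, Nat.card_fun]
    simp [idealNorm]
  rw [h₁, h₂, hker]
  ring

theorem charQuasi_eq_sum (A : Finset (Fin l → O)) (a : Ideal O) [Finite (O ⧸ a)] :
    charQuasi A a = ∑ J ∈ A.powerset, (-1 : ℤ) ^ J.card * Nat.card (flat J a) := by
  classical
  have := Fintype.ofFinite (O ⧸ a)
  let S : (Fin l → O) → Finset (Fin l → O ⧸ a) := fun c => (hyperplane c a).toFinset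
  have h₁ : complement A a = (A.inf fun c => (S c)ᶜ : Finset _) := by
    ext x
    simp [complement, Finset.mem_inf, S]
  have h₂ : ∀ J, flat J a = (J.inf S : Finset _) := fun J => by
    ext x
    simp [flat, Finset.mem_inf, S]
  rw [charQuasi, h₁, Set.ncard_coe_finset, Finset.inclusion_exclusion_card_inf_compl]
  refine Finset.sum_congr rfl fun J _ => ?_
  rw [h₂]
  simp

theorem card_flat [IsDedekindDomain O] [Ring.HasFiniteQuotients O] {J : Finset (Fin l → O)}
    {d : Fin (rk J) → Ideal O} (hd : IsInvariantIdeals J d) {a : Ideal O} (ha : a ≠ ⊥) :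
    Nat.card (flat J a) = mult J d a * idealNorm a ^ (l - rk J) := by
  have : Finite (O ⧸ a) := Ring.HasFiniteQuotients.finiteQuotient ha
  have hN : 0 < idealNorm a := Nat.card_pos
  have h := card_flat_mul J a
  rw [card_quotient_tensor_eq_torsion_mul ha, card_quotient_tensor_torsCoker hd,
    ← finrank_coker_add_rk J] at h
  refine Nat.eq_of_mul_eq_mul_right (pow_pos hN (Module.finrank O (Coker J) + rk J)) ?_
  rw [h]
  rw [mul_assoc, mul_assoc, ← pow_add, ← pow_add]
  congr 2
  have := rk_le J
  omega

end Counting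

/-! ### Period, constituents and monicity -/

section QuasiPolynomial

variable {O : Type*} [CommRing O] [IsDedekindDomain O] {l : ℕ}

theorem lastIdeal_ne_bot {J : Finset (Fin l → O)} {d : Fin (rk J) → Ideal O}
    (hd : IsInvariantIdeals J d) : lastIdeal J d ≠ ⊥ := by
  unfold lastIdeal
  split_ifs
  · exact hd.ne_bot _
  · exact top_ne_bot

variable {A : Finset (Fin l → O)} {d : (J : Finset (Fin l → O)) → Fin (rk J) → Ideal O}

theorem lcmPeriod_ne_bot (hd : ∀ J ⊆ A, IsInvariantIdeals J (d J)) : lcmPeriod A d ≠ ⊥ := by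
  refine Finset.inf_induction (p := fun I : Ideal O => I ≠ ⊥) top_ne_bot
    (fun I hI K hK h => ?_) fun J hJ => ?_
  · have : I * K = ⊥ := le_bot_iff.mp (h ▸ Ideal.mul_le_inf)
    exact mul_ne_zero hI hK this
  · exact lastIdeal_ne_bot (hd J (Finset.mem_powerset.mp (Finset.mem_filter.mp hJ).1))

theorem lcmPeriod_le (hd : ∀ J ⊆ A, IsInvariantIdeals J (d J)) {J : Finset (Fin l → O)}
    (hJ : J ⊆ A) (i : Fin (rk J)) : lcmPeriod A d ≤ d J i := by
  -- The period ranges over nonempty `J` only; an index `i` exists only when `r(J) > 0`.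
  have hne : J.Nonempty := Finset.card_pos.mp (i.pos.trans_le (rk_le_card J))
  exact (Finset.inf_le (Finset.mem_filter.mpr ⟨Finset.mem_powerset.mpr hJ, hne⟩)).trans
    (lastIdeal_le (hd J hJ) i)

theorem mult_add_lcmPeriod (hd : ∀ J ⊆ A, IsInvariantIdeals J (d J)) {J : Finset (Fin l → O)}
    (hJ : J ⊆ A) (a : Ideal O) : mult J (d J) (a + lcmPeriod A d) = mult J (d J) a := by
  refine Finset.prod_congr rfl fun i _ => ?_
  rw [add_assoc]
  exact congrArg (fun I => idealNorm (a + I)) (sup_eq_right.mpr (lcmPeriod_le hd hJ i))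

theorem isQuasiPolynomial_charQuasi [Ring.HasFiniteQuotients O]
    (hd : ∀ J ⊆ A, IsInvariantIdeals J (d J)) :
    IsQuasiPolynomial (charQuasi A) (lcmPeriod A d) (constituent A d) where
  period_ne_bot := lcmPeriod_ne_bot hd
  eval_eq := by
    rintro _ - a ha rfl
    have : Finite (O ⧸ a) := Ring.HasFiniteQuotients.finiteQuotient ha
    rw [charQuasi_eq_sum, constituent, eval_finsetSum]
    refine Finset.sum_congr rfl fun J hJ => ?_
    have hJ := Finset.mem_powerset.mp hJ
    rw [card_flat (hd J hJ) ha, mult_add_lcmPeriod hd hJ]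
    simp
    ring

/-- The leading term comes from `J = ∅`; any other `J` contains a nonzero vector, hence has positive
rank and contributes lower degree. -/
theorem exists_constituent_eq (h0 : (0 : Fin l → O) ∉ A) (κ : Ideal O) :
    ∃ p : ℤ[X], p.degree < l ∧ constituent A d κ = X ^ l + p := by
  classical
  refine ⟨_, ?_, (Finset.add_sum_erase _ _ (Finset.empty_mem_powerset A)).symm.trans
    (congrArg (· + _) ?_)⟩
  · rw [← mem_degreeLT]
    refine Submodule.sum_mem _ fun J hJ => mem_degreeLT.mpr ?_
    obtain ⟨hne, hJ⟩ := Finset.mem_erase.mp hJ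
    obtain ⟨c, hc⟩ := Finset.nonempty_iff_ne_empty.mpr hne
    have hpos : 0 < rk J :=
      rk_pos_of_mem hc fun h => h0 (h ▸ Finset.mem_powerset.mp hJ hc)
    have := rk_le J
    exact (degree_C_mul_X_pow_le _ _).trans_lt (by exact_mod_cast (by omega : l - rk J < l))
  · have hm : mult ∅ (d ∅) κ = 1 := by
      have : IsEmpty (Fin (rk (∅ : Finset (Fin l → O)))) := by
        rw [rk_empty]
        infer_instance
      exact Finset.prod_of_isEmpty _
    simp [hm, rk_empty]

theorem monic_constituent (h0 : (0 : Fin l → O) ∉ A) (κ : Ideal O) :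
    (constituent A d κ).Monic := by
  obtain ⟨p, hp, h⟩ := exists_constituent_eq (d := d) h0 κ
  exact h ▸ monic_X_pow_add hp

theorem natDegree_constituent (h0 : (0 : Fin l → O) ∉ A) (κ : Ideal O) :
    (constituent A d κ).natDegree = l := by
  obtain ⟨p, hp, h⟩ := exists_constituent_eq (d := d) h0 κ
  rw [h, natDegree_add_eq_left_of_degree_lt (by rwa [degree_X_pow]), natDegree_X_pow]

end QuasiPolynomial

end DedekindArrangement

theorem mainTheorem1 {O : Type*} [CommRing O] [IsDedekindDomain O] [Ring.HasFiniteQuotients O]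
    (l : ℕ) (A : Finset (Fin l → O)) :
    (∀ J ⊆ A, ∃ d : Fin (DedekindArrangement.rk J) → Ideal O,
      DedekindArrangement.IsInvariantIdeals J d) ∧
    ∀ d : (J : Finset (Fin l → O)) → Fin (DedekindArrangement.rk J) → Ideal O,
      (∀ J ⊆ A, DedekindArrangement.IsInvariantIdeals J (d J)) →
      DedekindArrangement.IsQuasiPolynomial (DedekindArrangement.charQuasi A)
        (DedekindArrangement.lcmPeriod A d) (DedekindArrangement.constituent A d) ∧
      ((0 : Fin l → O) ∉ A → ∀ κ : Ideal O, κ ∣ DedekindArrangement.lcmPeriod A d →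
        (DedekindArrangement.constituent A d κ).Monic ∧
        (DedekindArrangement.constituent A d κ).natDegree = l) ∧
      (∀ J ⊆ A, ∀ a : Ideal O, a ≠ ⊥ →
        Nat.card (DedekindArrangement.TorsCoker J ⧸
          (a • ⊤ : Submodule O (DedekindArrangement.TorsCoker J))) =
        DedekindArrangement.mult J (d J) a) := by
  refine ⟨fun J _ => DedekindArrangement.exists_isInvariantIdeals J, fun d hd =>
    ⟨DedekindArrangement.isQuasiPolynomial_charQuasi hd, fun h0 κ _ =>
      ⟨DedekindArrangement.monic_constituent h0 κ,
        DedekindArrangement.natDegree_constituent h0 κ⟩, fun J hJ a _ => ?_⟩⟩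
  rw [← Nat.card_congr (TensorProduct.quotTensorEquivQuotSMul
    (DedekindArrangement.TorsCoker J) a).toEquiv]
  exact DedekindArrangement.card_quotient_tensor_torsCoker (hd J hJ) a
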